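/- Let $M$ be a closed connected $d$-dimensional Riemannian manifold, let $p\colon\widetilde M\to M$ be its universal covering, where $\widetilde M$ carries the pulled-back Riemannian metric, and let $\Gamma\cong\pi_1(M)$ be the group of deck transformations. Let $X$ be the Cantor set endowed with a free continuous $\Gamma$-action, and let $\Gamma$ act diagonally on $X\times\widetilde M$. Write $B(q,r)$ for the open ball of radius $r>0$ around $q$ in $\widetilde M$, write $aB=B(q,ar)$ if $B=B(q,r)$, and put $V(1)=\sup_{q\in\widetilde M}\operatorname{vol}(B(q,1))$. A ball $B(q,r)\subset\widetilde M$ is called good if $$\operatorname{vol}(B(q,100r))\le 10^{4(d+3)}\operatorname{vol}\bigl(B(q,\tfrac1{100}r)\bigr),\qquad \operatorname{vol}(B(q,r))\le 10^{2(d+3)}\,V(1)\,r^{d+3},\qquad r\le\tfrac1{100}.$$ Then $X\times\widetilde M$ admits a good Cantor cover without self-intersections. That is, there are a free $\Gamma$-set $J$ with finitely many orbits, clopen sets $A_j\subset X$ and good balls $B_j=B(m_j,r_j)\subset\widetilde M$ for $j\in J$, such that 1. $A_{\gamma j}=\gamma A_j$, $m_{\gamma j}=\gamma m_j$, $r_{\gamma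 j}=r_j$, and hence $B_{\gamma j}=\gamma B_j$, for all $\gamma\in\Gamma$ and $j\in J$; 2. both $\{A_j\times B_j\mid j\in J\}$ and $\{A_j\times\frac12B_j\mid j\in J\}$ cover $X\times\widetilde M$; 3. for every $x\in X$ the family of the balls $B_j$ with $x\in A_j$ is a good cover of $\widetilde M$: these balls are good, they cover $\widetilde M$, the balls $\frac12B_j$ with $x\in A_j$ also cover $\widetilde M$, and the balls $\frac16B_j$ with $x\in A_j$ are pairwise disjoint; 4. if $(\gamma A_j\times\gamma B_j)\cap(A_j\times B_j)\ne\emptyset$ for some $j\in J$ and $\gamma\in\Gamma$, then $\gamma=1$. -/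

import Mathlib

open Set Metric MeasureTheory Bundle
open scoped Manifold ContDiff Pointwise

universe v

/-- `p : N → M` is a universal Riemannian covering of `d`-dimensional Riemannian manifolds: a
smooth covering map with simply connected total space, such that the Riemannian metric of `N` is
the pullback of the Riemannian metric of `M` along `p`. -/
structure IsUniversalRiemannianCovering (d : ℕ) {M N : Type*}
    [TopologicalSpace M] [ChartedSpace (EuclideanSpace ℝ (Fin d)) M]
    [RiemannianBundle (fun x : M => TangentSpace (𝓡 d) x)]
    [TopologicalSpace N] [ChartedSpace (EuclideanSpace ℝ (Fin d)) N]
    [RiemannianBundle (fun y : N => TangentSpace (𝓡 d) y)]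
    (p : N → M) : Prop where
  isCoveringMap : IsCoveringMap p
  simplyConnected : SimplyConnectedSpace N
  contMDiff : ContMDiff (𝓡 d) (𝓡 d) ∞ p
  inner_mfderiv : ∀ (y : N) (v w : TangentSpace (𝓡 d) y),
    inner ℝ (mfderiv (𝓡 d) (𝓡 d) p y v) (mfderiv (𝓡 d) (𝓡 d) p y w) = inner ℝ v w

/-- The group of deck transformations of a map `p : N → M`. If `p` is a universal covering, this
is the fundamental group of `M` in its usual action on the universal cover. -/
def DeckGroup {M N : Type*} [TopologicalSpace N] (p : N → M) : Subgroup (N ≃ₜ N) where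
  carrier := {f | ∀ y, p (f y) = p y}
  one_mem' := fun _ => rfl
  mul_mem' := fun {f g} hf hg y => (hf (g y)).trans (hg y)
  inv_mem' := fun {f} hf y => by
    have h := hf (f.symm y)
    rw [f.apply_symm_apply] at h
    exact h.symm

/-- Deck transformations act on the total space by evaluation. -/
instance DeckGroup.instMulAction {M N : Type*} [TopologicalSpace N] (p : N → M) :
    MulAction (DeckGroup p) N where
  smul γ y := (γ : N ≃ₜ N) y
  one_smul _ := rfl
  mul_smul _ _ _ := rfl

/-- An action is free if only the identity has fixed points. -/
def IsFreeAction (G S : Type*) [Group G] [MulAction G S] : Prop :=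
  ∀ (γ : G) (s : S), γ • s = s → γ = 1

/-- `V_N(1)`: the supremal volume of balls of radius `1` in the `d`-dimensional Riemannian
manifold `N`. The Riemannian volume is the `d`-dimensional Hausdorff measure `μHE[d]` of the
Riemannian distance, normalized so as to agree with Lebesgue measure on Euclidean space. -/
noncomputable def supVolUnitBall (d : ℕ) (N : Type*) [MetricSpace N] [MeasurableSpace N]
    [BorelSpace N] : ENNReal :=
  ⨆ q : N, μHE[d] (ball q 1)

/-- The open ball of radius `r` around `q` is a good ball. -/
structure IsGoodBall (d : ℕ) {N : Type*} [MetricSpace N] [MeasurableSpace N] [BorelSpace N]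
    (q : N) (r : ℝ) : Prop where
  radius_pos : 0 < r
  reasonable_growth :
    μHE[d] (ball q (100 * r)) ≤ 10 ^ (4 * (d + 3)) * μHE[d] (ball q (1 / 100 * r))
  volume_bound :
    μHE[d] (ball q r) ≤ 10 ^ (2 * (d + 3)) * supVolUnitBall d N * ENNReal.ofReal r ^ (d + 3)
  small_radius : r ≤ 1 / 100

/-- The balls with centers `c i` and radii `r i` form a good cover of `N`. -/
structure IsGoodCover (d : ℕ) {N ι : Type*} [MetricSpace N] [MeasurableSpace N] [BorelSpace N]
    (c : ι → N) (r : ι → ℝ) : Prop where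
  good_ball : ∀ i, IsGoodBall d (c i) (r i)
  cover : ⋃ i, ball (c i) (r i) = univ
  cover_half : ⋃ i, ball (c i) (1 / 2 * r i) = univ
  disjoint_sixth : ∀ i i', i ≠ i' → Disjoint (ball (c i) (1 / 6 * r i)) (ball (c i') (1 / 6 * r i'))

/-- A Cantor cover of `X × N`, for spaces `X` and `N` with actions of `Γ`, with index set `J`. Its
elements are the products of the clopen set `A j` with the open ball `B j` of radius `radius j`
around `center j`. -/
structure CantorCover (Γ X N J : Type*) [Group Γ] [TopologicalSpace X] [MulAction Γ X]
    [MetricSpace N] [MulAction Γ N] [MulAction Γ J] where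
  A : J → Set X
  center : J → N
  radius : J → ℝ
  free : IsFreeAction Γ J
  cofinite : Finite (MulAction.orbitRel.Quotient Γ J)
  isClopen : ∀ j, IsClopen (A j)
  radius_pos : ∀ j, 0 < radius j
  A_smul : ∀ (γ : Γ) (j : J), A (γ • j) = γ • A j
  center_smul : ∀ (γ : Γ) (j : J), center (γ • j) = γ • center j
  radius_smul : ∀ (γ : Γ) (j : J), radius (γ • j) = radius j
  ball_smul : ∀ (γ : Γ) (j : J),
    ball (center (γ • j)) (radius (γ • j)) = γ • ball (center j) (radius j)
  cover : ⋃ j, A j ×ˢ ball (center j) (radius j) = univ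
  cover_half : ⋃ j, A j ×ˢ ball (center j) (1 / 2 * radius j) = univ

namespace CantorCover

variable {Γ X N J : Type*} [Group Γ] [TopologicalSpace X] [MulAction Γ X]
    [MetricSpace N] [MulAction Γ N] [MulAction Γ J]

/-- The open ball `B j`. -/
def B (U : CantorCover Γ X N J) (j : J) : Set N := ball (U.center j) (U.radius j)

/-- A Cantor cover is good if for every `x` the balls `B j` with `x ∈ A j` form a good cover. -/
def IsGood (U : CantorCover Γ X N J) (d : ℕ) [MeasurableSpace N] [BorelSpace N] : Prop :=
  ∀ x : X, IsGoodCover d (fun j : {j : J // x ∈ U.A j} => U.center j)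
    (fun j : {j : J // x ∈ U.A j} => U.radius j)

/-- No element of the cover meets one of its translates by a nontrivial element of `Γ`. -/
def NoSelfIntersections (U : CantorCover Γ X N J) : Prop :=
  ∀ (γ : Γ) (j : J),
    (((γ • U.A j) ×ˢ (γ • U.B j)) ∩ (U.A j ×ˢ U.B j)).Nonempty → γ = 1

end CantorCover

/-!
The cover is built by a greedy Vitali argument that is run simultaneously over all points of the
Cantor set `X`.

*Good balls exist around every point.* A small ball of radius `r` has volume at least `c * r ^ d`
(`exists_mul_pow_le_volume_ball`, by comparison with a chart). If reasonable growth failed at all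
the radii `10⁻⁴ᵏ / 100`, volumes would decay like `r ^ (d + 3)`, a contradiction. At the first
radius with reasonable growth, the failures at the previous ones give the volume bound
(`exists_isGoodBall`). This uses that `V(1)` is finite, which holds because the deck group acts
cocompactly on the proper space `N` (`supVolUnitBall_lt_top_of_cocompact`).

*The geometry of the deck group.* Deck transformations are smooth with isometric derivative, as
they are locally `q ∘ p` for a smooth local inverse `q` of `p`; hence they are isometries
(`DeckGroup.isIsometricSMul`). They act freely, and transitively on fibres because `N` is simply
connected, so a compact set meets all orbits. Together with the length space property this shows
that `N` is proper (`properSpace_of_isCompact_closedBall`), so that only finitely many translates of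
a ball meet a given ball (`DeckGroup.finite_setOf_ball_smul_inter_nonempty`).

*The cover.* By compactness, finitely many orbits of good balls `B i` are such that the balls
`1/6 B i` cover `N`. Since `Γ` acts freely on `X`, for each `i` the space `X` is covered by finitely
many clopen sets `P` that are disjoint from `γ • P` for each of the finitely many `γ ≠ 1` for which
`γ • B i` meets `B i`. List the pairs `(B k, P k)` of a ball and a clopen set by decreasing radius,
and let `A k` consist of the points of `P k` that are in no `γ • A l` with `l < k` for which
`γ • 1/6 B l` meets `1/6 B k` (`greedySelection`). Then `J = Γ × Fin L`, with the sets `γ • A k` and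
the balls `γ • B k`, is the required cover: `A k ⊆ P k` excludes self-intersections, the greedy
choice makes the sixths disjoint over every `x`, and a sixth that has been discarded over `x` lies
in the half of an earlier, larger ball (`exists_cantorCover_of_antitone`).
-/

open Manifold Topology Filter
open scoped ENNReal NNReal

/-! ### Lengths of paths under maps with bounded derivative -/

section Length

variable {E : Type*} [NormedAddCommGroup E] [NormedSpace ℝ E]
  {H : Type*} [TopologicalSpace H] {I : ModelWithCorners ℝ E H}
  {M : Type*} [TopologicalSpace M] [ChartedSpace H M] [∀ x : M, ENorm (TangentSpace I x)]
  {E' : Type*} [NormedAddCommGroup E'] [NormedSpace ℝ E']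
  {H' : Type*} [TopologicalSpace H'] {I' : ModelWithCorners ℝ E' H'}
  {M' : Type*} [TopologicalSpace M'] [ChartedSpace H' M'] [∀ x : M', ENorm (TangentSpace I' x)]

theorem pathELength_comp_le_mul {f : M → M'} {U : Set M} {C : ℝ≥0} (hU : IsOpen U)
    (hf : ContMDiffOn I I' 1 f U)
    (hC : ∀ x ∈ U, ∀ v : TangentSpace I x, ‖mfderiv I I' f x v‖ₑ ≤ C * ‖v‖ₑ)
    {c : ℝ → M} {a b : ℝ} (hab : a < b) (hc : ContMDiffOn 𝓘(ℝ, ℝ) I 1 c (Icc a b))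
    (hcU : MapsTo c (Icc a b) U) :
    pathELength I' (f ∘ c) a b ≤ C * pathELength I c a b := by
  rw [pathELength_eq_lintegral_mfderivWithin_Icc, pathELength_eq_lintegral_mfderivWithin_Icc,
    ← lintegral_const_mul' _ _ ENNReal.coe_ne_top]
  refine setLIntegral_mono' measurableSet_Icc fun t ht ↦ ?_
  have huniq : UniqueMDiffWithinAt 𝓘(ℝ, ℝ) (Icc a b) t := by
    rw [uniqueMDiffWithinAt_iff_uniqueDiffWithinAt]
    exact uniqueDiffOn_Icc hab t ht
  have hfd : MDifferentiableAt I I' f (c t) :=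
    (hf.contMDiffAt (hU.mem_nhds (hcU ht))).mdifferentiableAt one_ne_zero
  have hcomp : mfderivWithin 𝓘(ℝ, ℝ) I' (f ∘ c) (Icc a b) t =
      (mfderiv I I' f (c t)).comp (mfderivWithin 𝓘(ℝ, ℝ) I c (Icc a b) t) :=
    mfderiv_comp_mfderivWithin t hfd (hc.mdifferentiableOn one_ne_zero t ht) huniq
  have happ : mfderivWithin 𝓘(ℝ, ℝ) I' (f ∘ c) (Icc a b) t 1 =
      mfderiv I I' f (c t) (mfderivWithin 𝓘(ℝ, ℝ) I c (Icc a b) t 1) := congr($hcomp 1)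
  rw [happ]
  exact hC _ (hcU ht) _

/-- A `C¹` path is stretched by at most the factor `C` under a map whose derivative is bounded
by `C` along the path. -/
theorem riemannianEDist_le_mul_pathELength {f : M → M'} {U : Set M} {C : ℝ≥0} (hU : IsOpen U)
    [∀ y : M', ENormSMulClass ℝ (TangentSpace I' y)]
    (hf : ContMDiffOn I I' 1 f U)
    (hC : ∀ x ∈ U, ∀ v : TangentSpace I x, ‖mfderiv I I' f x v‖ₑ ≤ C * ‖v‖ₑ)
    {c : ℝ → M} {a b : ℝ} (hab : a < b) (hc : ContMDiffOn 𝓘(ℝ, ℝ) I 1 c (Icc a b))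
    (hcU : MapsTo c (Icc a b) U) :
    riemannianEDist I' (f (c a)) (f (c b)) ≤ C * pathELength I c a b :=
  (riemannianEDist_le_pathELength (hf.comp hc hcU) rfl rfl hab.le).trans
    (pathELength_comp_le_mul hU hf hC hab hc hcU)

end Length

/-! ### Lipschitz maps between Riemannian manifolds -/

section Lipschitz

variable {E : Type*} [NormedAddCommGroup E] [NormedSpace ℝ E]
  {H : Type*} [TopologicalSpace H] {I : ModelWithCorners ℝ E H}
  {M : Type*} [PseudoMetricSpace M] [ChartedSpace H M]
  [RiemannianBundle (fun x : M => TangentSpace I x)] [IsRiemannianManifold I M]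
  {E' : Type*} [NormedAddCommGroup E'] [NormedSpace ℝ E']
  {H' : Type*} [TopologicalSpace H'] {I' : ModelWithCorners ℝ E' H'}
  {M' : Type*} [PseudoMetricSpace M'] [ChartedSpace H' M']
  [RiemannianBundle (fun x : M' => TangentSpace I' x)] [IsRiemannianManifold I' M']

theorem edist_le_pathELength {c : ℝ → M} {a b s t : ℝ}
    (hc : ContMDiffOn 𝓘(ℝ, ℝ) I 1 c (Icc a b)) (has : a ≤ s) (hst : s ≤ t) (htb : t ≤ b) :
    edist (c s) (c t) ≤ pathELength I c s t := by
  rw [IsRiemannianManifold.out (I := I) (c s) (c t)]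
  exact riemannianEDist_le_pathELength (hc.mono (Icc_subset_Icc has htb)) rfl rfl hst

/-- The ball of definition has three times the radius because an almost shortest path between two
points of `ball q ρ` may leave `ball q ρ`, but stays in `ball q (3 * ρ)`. -/
theorem lipschitzOnWith_ball_of_enorm_mfderiv_le {f : M → M'} {q : M} {ρ : ℝ} {C : ℝ≥0}
    (hf : ContMDiffOn I I' 1 f (ball q (3 * ρ)))
    (hC : ∀ x ∈ ball q (3 * ρ), ∀ v : TangentSpace I x, ‖mfderiv I I' f x v‖ₑ ≤ C * ‖v‖ₑ) :
    LipschitzOnWith C f (ball q ρ) := by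
  intro y hy z hz
  have hyz : edist y z < ENNReal.ofReal (2 * ρ) := by
    rw [edist_lt_ofReal]
    have := dist_triangle_right y z q
    rw [mem_ball] at hy hz
    linarith
  have key : ∀ L : ℝ≥0∞, edist y z < L → edist (f y) (f z) ≤ C * L := by
    intro L hL
    have hlt : riemannianEDist I y z < min L (ENNReal.ofReal (2 * ρ)) := by
      rw [← IsRiemannianManifold.out (I := I) y z]
      exact lt_min hL hyz
    obtain ⟨c, rfl, rfl, hc, hlen⟩ := exists_lt_of_riemannianEDist_lt hlt
    have hmaps : MapsTo c (Icc 0 1) (ball q (3 * ρ)) := by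
      intro t ht
      have h1 : edist (c 0) (c t) < ENNReal.ofReal (2 * ρ) :=
        calc edist (c 0) (c t) ≤ pathELength I c 0 t := edist_le_pathELength hc le_rfl ht.1 ht.2
          _ ≤ pathELength I c 0 1 := pathELength_mono le_rfl ht.2
          _ < _ := hlen.trans_le (min_le_right _ _)
      rw [edist_lt_ofReal] at h1
      have := dist_triangle_left (c t) q (c 0)
      rw [mem_ball] at hy ⊢
      linarith
    rw [IsRiemannianManifold.out (I := I') (f (c 0)) (f (c 1))]
    refine (riemannianEDist_le_mul_pathELength isOpen_ball hf hC zero_lt_one hc hmaps).trans ?_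
    gcongr
    exact (hlen.trans_le (min_le_left _ _)).le
  rcases eq_or_ne C 0 with rfl | hC0
  · simpa using key _ hyz
  · have hC0' : (C : ℝ≥0∞) ≠ 0 := by exact_mod_cast hC0
    rw [mul_comm, ← ENNReal.div_le_iff_le_mul (Or.inl hC0') (Or.inl ENNReal.coe_ne_top)]
    refine le_of_forall_gt_imp_ge_of_dense fun L hL ↦ ?_
    rw [ENNReal.div_le_iff_le_mul (Or.inl hC0') (Or.inl ENNReal.coe_ne_top), mul_comm]
    exact key L hL

end Lipschitz

/-! ### Charts of a Riemannian manifold are locally bi-Lipschitz -/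

section Chart

variable {F : Type*} [NormedAddCommGroup F] [InnerProductSpace ℝ F]
  {H : Type*} [TopologicalSpace H] (I : ModelWithCorners ℝ F H)
  {M : Type*} [PseudoMetricSpace M] [ChartedSpace H M] [IsManifold I 1 M]
  [RiemannianBundle (fun x : M => TangentSpace I x)]
  [IsContinuousRiemannianBundle F (fun x : M => TangentSpace I x)]

attribute [local instance] normedAddCommGroupTangentSpaceVectorSpace
  normedSpaceTangentSpaceVectorSpace in
theorem eventually_enorm_mfderiv_extChartAt_apply_le (q : M) :
    ∃ C : ℝ≥0, ∀ᶠ y in 𝓝 q, ∀ v : TangentSpace I y,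
      (‖(mfderiv I 𝓘(ℝ, F) (extChartAt I q) y v : F)‖ₑ) ≤ C * ‖v‖ₑ := by
  obtain ⟨C, -, hC⟩ := eventually_enorm_mfderiv_extChartAt_lt I q
  refine ⟨C, hC.mono fun y hy v ↦ ?_⟩
  refine (ContinuousLinearMap.le_opENorm _ _).trans ?_
  gcongr
  exact hy.le

attribute [local instance] normedAddCommGroupTangentSpaceVectorSpace
  normedSpaceTangentSpaceVectorSpace in
theorem eventually_enorm_mfderiv_extChartAt_symm_apply_le [I.Boundaryless] (q : M) :
    ∃ C : ℝ≥0, ∀ᶠ y in 𝓝 (extChartAt I q q), ∀ v : F,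
      ‖mfderiv 𝓘(ℝ, F) I (extChartAt I q).symm y v‖ₑ ≤ C * ‖v‖ₑ := by
  obtain ⟨C, -, hC⟩ := eventually_enorm_mfderivWithin_symm_extChartAt_lt I q
  rw [I.range_eq_univ, nhdsWithin_univ] at hC
  refine ⟨C, hC.mono fun y hy v ↦ ?_⟩
  rw [mfderivWithin_univ] at hy
  refine (ContinuousLinearMap.le_opENorm _ _).trans ?_
  gcongr
  · exact hy.le
  · rfl

variable [IsRiemannianManifold I M]

theorem exists_lipschitzOnWith_extChartAt (q : M) :
    ∃ C : ℝ≥0, ∃ ρ > 0, LipschitzOnWith C (extChartAt I q) (ball q ρ) := by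
  obtain ⟨C, hC⟩ := eventually_enorm_mfderiv_extChartAt_apply_le I q
  obtain ⟨ε, hε, hball⟩ := Metric.mem_nhds_iff.1 (hC.and (chart_source_mem_nhds H q))
  have h3 : 3 * (ε / 3) = ε := by ring
  refine ⟨C, ε / 3, by positivity, lipschitzOnWith_ball_of_enorm_mfderiv_le (I := I)
    (I' := 𝓘(ℝ, F)) ?_ ?_⟩
  · rw [h3]
    exact contMDiffOn_extChartAt.mono fun y hy ↦ (hball hy).2
  · rw [h3]
    intro y hy v
    rw [enorm_tangentSpace_vectorSpace]
    exact (hball hy).1 v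

theorem exists_lipschitzOnWith_extChartAt_symm [I.Boundaryless] (q : M) :
    ∃ C : ℝ≥0, ∃ ρ > 0, ball (extChartAt I q q) ρ ⊆ (extChartAt I q).target ∧
      LipschitzOnWith C (extChartAt I q).symm (ball (extChartAt I q q) ρ) := by
  obtain ⟨C, hC⟩ := eventually_enorm_mfderiv_extChartAt_symm_apply_le I q
  obtain ⟨ε, hε, hball⟩ := Metric.mem_nhds_iff.1 (hC.and (extChartAt_target_mem_nhds q))
  have h3 : 3 * (ε / 3) = ε := by ring
  refine ⟨C, ε / 3, by positivity, fun y hy ↦ (hball (ball_subset_ball (by linarith) hy)).2,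
    lipschitzOnWith_ball_of_enorm_mfderiv_le (I := 𝓘(ℝ, F)) (I' := I) ?_ ?_⟩
  · rw [h3]
    exact (contMDiffOn_extChartAt_symm q).mono fun y hy ↦ (hball hy).2
  · rw [h3]
    intro y hy v
    rw [enorm_tangentSpace_vectorSpace]
    exact (hball hy).1 v

end Chart

/-! ### The Riemannian volume of small balls -/

section Volume

theorem LipschitzOnWith.euclideanHausdorffMeasure_image_le {Y Z : Type*} [EMetricSpace Y]
    [MeasurableSpace Y] [BorelSpace Y] [EMetricSpace Z] [MeasurableSpace Z] [BorelSpace Z]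
    {K : ℝ≥0} {f : Y → Z} {s : Set Y} (h : LipschitzOnWith K f s) (d : ℕ) :
    μHE[d] (f '' s) ≤ (K : ℝ≥0∞) ^ d * μHE[d] s := by
  simp only [Measure.euclideanHausdorffMeasure_def, Measure.smul_apply, ENNReal.smul_def,
    smul_eq_mul]
  have := h.hausdorffMeasure_image_le (d := d) (by positivity)
  rw [ENNReal.rpow_natCast] at this
  rw [mul_left_comm]
  gcongr

variable {d : ℕ} {N : Type*} [MetricSpace N] [MeasurableSpace N] [BorelSpace N]
    [ChartedSpace (EuclideanSpace ℝ (Fin d)) N] [IsManifold (𝓡 d) 1 N]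
    [RiemannianBundle (fun y : N => TangentSpace (𝓡 d) y)]
    [IsContinuousRiemannianBundle (EuclideanSpace ℝ (Fin d))
      (fun y : N => TangentSpace (𝓡 d) y)]
    [IsRiemannianManifold (𝓡 d) N]

/-- Small balls in a Riemannian manifold have at least Euclidean volume growth, up to a factor. -/
theorem exists_mul_pow_le_volume_ball (q : N) :
    ∃ c : ℝ≥0∞, c ≠ 0 ∧ ∃ ρ > 0, ∀ r, 0 < r → r ≤ ρ →
      c * ENNReal.ofReal r ^ d ≤ μHE[d] (ball q r) := by
  obtain ⟨C₁, ρ₁, hρ₁, h₁⟩ := exists_lipschitzOnWith_extChartAt (𝓡 d) q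
  obtain ⟨C₂, ρ₂, hρ₂, htarget, h₂⟩ := exists_lipschitzOnWith_extChartAt_symm (𝓡 d) q
  set φ := extChartAt (𝓡 d) q with hφ
  have hK : (0 : ℝ) < C₂ + 1 := by positivity
  refine ⟨ENNReal.ofReal (1 / (C₂ + 1)) ^ d *
    volume (ball (0 : EuclideanSpace ℝ (Fin d)) 1) / ((C₁ : ℝ≥0∞) + 1) ^ d, ?_,
    min ρ₁ ((C₂ + 1) * ρ₂), lt_min hρ₁ (by positivity), fun r hr hrρ ↦ ?_⟩
  · refine (ENNReal.div_pos (mul_ne_zero ?_ ?_) (by finiteness)).ne'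
    · exact pow_ne_zero _ (by simpa using by positivity)
    · exact (measure_ball_pos _ _ one_pos).ne'
  have hr₁ : r ≤ ρ₁ := hrρ.trans (min_le_left _ _)
  have hr₂ : r / (C₂ + 1) ≤ ρ₂ := by
    rw [div_le_iff₀' hK]
    exact hrρ.trans (min_le_right _ _)
  -- `φ.symm` maps the ball of radius `r / (C₂ + 1)` into `ball q r`.
  have hsub : ball (φ q) (r / (C₂ + 1)) ⊆ φ '' ball q r := by
    intro w hw
    have hw₂ : w ∈ ball (φ q) ρ₂ := ball_subset_ball hr₂ hw
    refine ⟨φ.symm w, ?_, φ.right_inv (htarget hw₂)⟩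
    have hdist := h₂.dist_le_mul w hw₂ (φ q) (mem_ball_self hρ₂)
    rw [φ.left_inv (mem_extChartAt_source q)] at hdist
    rw [mem_ball, lt_div_iff₀' hK] at hw
    rw [mem_ball]
    nlinarith [dist_nonneg (x := w) (y := φ q)]
  have hvol : ENNReal.ofReal (r / (C₂ + 1)) ^ d * volume (ball (0 : EuclideanSpace ℝ (Fin d)) 1)
      ≤ (C₁ : ℝ≥0∞) ^ d * μHE[d] (ball q r) := by
    have h := Measure.addHaar_ball_of_pos (volume : Measure (EuclideanSpace ℝ (Fin d))) (φ q)
      (show 0 < r / (C₂ + 1) by positivity)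
    rw [finrank_euclideanSpace_fin, ENNReal.ofReal_pow (by positivity)] at h
    rw [← h, ← EuclideanSpace.euclideanHausdorffMeasure_eq_volume]
    exact (measure_mono hsub).trans
      ((h₁.mono (ball_subset_ball hr₁)).euclideanHausdorffMeasure_image_le d)
  have hC₁ : ((C₁ : ℝ≥0∞) + 1) ^ d ≠ 0 := pow_ne_zero _ (by simp)
  rw [mul_comm, ← mul_div_assoc, ENNReal.div_le_iff hC₁ (by finiteness), ← mul_assoc, ← mul_pow,
    ← ENNReal.ofReal_mul hr.le, mul_one_div, mul_comm (μHE[d] _)]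
  refine hvol.trans ?_
  gcongr
  exact le_self_add

theorem isLocallyFiniteMeasure_euclideanHausdorffMeasure :
    IsLocallyFiniteMeasure (μHE[d] : Measure N) := by
  refine ⟨fun q ↦ ?_⟩
  obtain ⟨C, ρ, hρ, htarget, h⟩ := exists_lipschitzOnWith_extChartAt_symm (𝓡 d) q
  refine ⟨(extChartAt (𝓡 d) q).symm '' ball (extChartAt (𝓡 d) q q) ρ, ?_, ?_⟩
  · filter_upwards [extChartAt_source_mem_nhds (I := 𝓡 d) q,
      (continuousAt_extChartAt (I := 𝓡 d) q).preimage_mem_nhds (ball_mem_nhds _ hρ)] with y hy hyρ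
    exact ⟨_, hyρ, (extChartAt (𝓡 d) q).left_inv hy⟩
  · refine (h.euclideanHausdorffMeasure_image_le d).trans_lt ?_
    rw [EuclideanSpace.euclideanHausdorffMeasure_eq_volume]
    exact ENNReal.mul_lt_top (by finiteness) measure_ball_lt_top

end Volume

/-! ### Deck transformations of a universal covering -/

section Covering

variable {M N : Type*} [TopologicalSpace N] {p : N → M}

theorem DeckGroup.proj_smul (γ : DeckGroup p) (y : N) : p (γ • y) = p y := γ.2 y

variable [TopologicalSpace M]

theorem DeckGroup.isFreeAction [PreconnectedSpace N] (hp : IsCoveringMap p) :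
    IsFreeAction (DeckGroup p) N := by
  intro γ y hy
  refine Subtype.ext (Homeomorph.ext fun z ↦ ?_)
  have := hp.eq_of_comp_eq (γ : N ≃ₜ N).continuous continuous_id (funext γ.2) y hy
  exact congrFun this z

theorem DeckGroup.exists_smul_eq [SimplyConnectedSpace N] [LocallyPathConnectedSpace N]
    (hp : IsCoveringMap p) {y z : N} (hyz : p y = p z) : ∃ γ : DeckGroup p, γ • y = z := by
  obtain ⟨f, ⟨hfy, hpf⟩, -⟩ := hp.existsUnique_continuousMap_lifts ⟨p, hp.continuous⟩ y z hyz.symm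
  obtain ⟨g, ⟨hgz, hpg⟩, -⟩ := hp.existsUnique_continuousMap_lifts ⟨p, hp.continuous⟩ z y hyz
  have hpf' : ∀ x, p (f x) = p x := congrFun hpf
  have hpg' : ∀ x, p (g x) = p x := congrFun hpg
  have hgf : g ∘ f = id := hp.eq_of_comp_eq (g.continuous.comp f.continuous) continuous_id
    (funext fun x ↦ (hpg' _).trans (hpf' x)) y (by simp [hfy, hgz])
  have hfg : f ∘ g = id := hp.eq_of_comp_eq (f.continuous.comp g.continuous) continuous_id
    (funext fun x ↦ (hpf' _).trans (hpg' x)) z (by simp [hfy, hgz])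
  exact ⟨⟨⟨⟨f, g, congrFun hgf, congrFun hfg⟩, f.continuous, g.continuous⟩, hpf'⟩, hfy⟩

theorem IsCoveringMap.surjective_of_pathConnectedSpace [PathConnectedSpace M] [Nonempty N]
    (hp : IsCoveringMap p) : Function.Surjective p := by
  intro x
  obtain ⟨y⟩ := ‹Nonempty N›
  let c : Path (p y) x := PathConnectedSpace.somePath _ _
  obtain ⟨Γ, hΓ, -⟩ := hp.exists_path_lifts c y c.source
  exact ⟨Γ 1, (congrFun hΓ 1).trans c.target⟩

end Covering

/-! ### Smoothness of local inverses -/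

section LocalInverse

variable {E : Type*} [NormedAddCommGroup E] [NormedSpace ℝ E] [CompleteSpace E]
  {M N : Type*} [TopologicalSpace M] [ChartedSpace E M] [TopologicalSpace N] [ChartedSpace E N]

/-- The inverse of a local homeomorphism is as smooth as the map itself wherever the derivative of
the latter is invertible. -/
theorem OpenPartialHomeomorph.contMDiffAt_symm {n : ℕ∞ω} (hn : n ≠ 0)
    (e : OpenPartialHomeomorph N M) {a : M} (ha : a ∈ e.target)
    (he : ContMDiffAt 𝓘(ℝ, E) 𝓘(ℝ, E) n e (e.symm a)) (L : E ≃L[ℝ] E)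
    (hL : ∀ v : E, mfderiv 𝓘(ℝ, E) 𝓘(ℝ, E) e (e.symm a) v = L v) :
    ContMDiffAt 𝓘(ℝ, E) 𝓘(ℝ, E) n e.symm a := by
  set y := e.symm a with hy
  have hey : e y = a := e.right_inv ha
  let f : OpenPartialHomeomorph E E := ((chartAt E y).symm.trans e).trans (chartAt E a)
  have hfsymm : f.symm (chartAt E a a) = chartAt E y y := by
    simp [f, ← hy]
  have hd := (he.mdifferentiableAt hn).hasMFDerivAt.2
  have hcd := (contMDiffAt_iff.1 he).2
  simp only [writtenInExtChartAt, mfld_simps, hey] at hd hcd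
  rw [contDiffWithinAt_univ] at hcd
  have hD : (L : E →L[ℝ] E) = mfderiv 𝓘(ℝ, E) 𝓘(ℝ, E) e y :=
    ContinuousLinearMap.ext fun v ↦ (hL v).symm
  have hd' : HasFDerivAt f (L : E →L[ℝ] E) (f.symm (chartAt E a a)) := by
    rw [hfsymm, hD]
    exact hasFDerivWithinAt_univ.1 hd
  have hf := f.contDiffAt_symm (n := n) (a := chartAt E a a) (by simp [f, ← hy, ha]) hd'
    (by rw [hfsymm]; exact hcd)
  rw [contMDiffAt_iff]
  refine ⟨e.symm.continuousAt ha, ?_⟩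
  simp only [mfld_simps]
  rw [contDiffWithinAt_univ]
  exact hf

end LocalInverse

/-! ### Deck transformations are isometries -/

section Isometry

variable {d : ℕ} {M N : Type*}
    [TopologicalSpace M] [ChartedSpace (EuclideanSpace ℝ (Fin d)) M]
    [RiemannianBundle (fun x : M => TangentSpace (𝓡 d) x)]

section

variable [TopologicalSpace N] [ChartedSpace (EuclideanSpace ℝ (Fin d)) N]
    [RiemannianBundle (fun y : N => TangentSpace (𝓡 d) y)]
    {p : N → M}

/-- The derivative preserves the metric, so it is injective, and both manifolds have dimension
`d`. -/
theorem IsUniversalRiemannianCovering.exists_mfderiv_eq_equiv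
    (hp : IsUniversalRiemannianCovering d p) (y : N) :
    ∃ L : EuclideanSpace ℝ (Fin d) ≃L[ℝ] EuclideanSpace ℝ (Fin d),
      ∀ v : EuclideanSpace ℝ (Fin d), mfderiv (𝓡 d) (𝓡 d) p y v = L v := by
  let D : EuclideanSpace ℝ (Fin d) →L[ℝ] EuclideanSpace ℝ (Fin d) := mfderiv (𝓡 d) (𝓡 d) p y
  have hD : Function.Injective D := by
    refine (injective_iff_map_eq_zero D).2 fun v hv ↦ ?_
    have h := hp.inner_mfderiv y v v
    rw [show mfderiv (𝓡 d) (𝓡 d) p y v = 0 from hv, inner_zero_left] at h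
    exact (inner_self_eq_zero (𝕜 := ℝ) (E := TangentSpace (𝓡 d) y)).1 h.symm
  exact ⟨(LinearEquiv.ofInjectiveEndo (D : _ →ₗ[ℝ] _) hD).toContinuousLinearEquiv, fun v ↦ rfl⟩

theorem DeckGroup.contMDiff (hp : IsUniversalRiemannianCovering d p) (γ : DeckGroup p) :
    ContMDiff (𝓡 d) (𝓡 d) ∞ (fun y : N ↦ γ • y) := by
  intro y
  -- Near `y`, the deck transformation is `e.symm ∘ p` for the local inverse `e.symm` of `p` with
  -- value `γ • y` at `p y`.
  obtain ⟨e, hye, hpe⟩ := hp.isCoveringMap.isLocalHomeomorph (γ • y)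
  have hpe' : ∀ z, p z = e z := congrFun hpe
  have hsymm : e.symm (p y) = γ • y := by
    rw [← DeckGroup.proj_smul γ y, hpe', e.left_inv hye]
  obtain ⟨L, hL⟩ := hp.exists_mfderiv_eq_equiv (γ • y)
  have hinv : ContMDiffAt (𝓡 d) (𝓡 d) ∞ e.symm (p y) := by
    refine e.contMDiffAt_symm (by simp) ?_ ?_ L ?_
    · rw [← DeckGroup.proj_smul γ y, hpe']
      exact e.map_source hye
    · rw [hsymm, ← hpe]
      exact hp.contMDiff _
    · rw [hsymm, ← hpe]
      exact hL
  refine (hinv.comp y (hp.contMDiff y)).congr_of_eventuallyEq ?_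
  have hcont : Continuous fun y : N ↦ γ • y := (γ : N ≃ₜ N).continuous
  filter_upwards [hcont.continuousAt.preimage_mem_nhds (e.open_source.mem_nhds hye)] with z hz
  rw [Function.comp_apply, ← DeckGroup.proj_smul γ z, hpe', e.left_inv hz]

theorem DeckGroup.enorm_mfderiv [IsManifold (𝓡 d) ∞ N]
    (hp : IsUniversalRiemannianCovering d p) (γ : DeckGroup p) (y : N)
    (v : TangentSpace (𝓡 d) y) :
    ‖mfderiv (𝓡 d) (𝓡 d) (fun y : N ↦ γ • y) y v‖ₑ = ‖v‖ₑ := by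
  have hchain : mfderiv (𝓡 d) (𝓡 d) (p ∘ fun y : N ↦ γ • y) y =
      (mfderiv (𝓡 d) (𝓡 d) p (γ • y)).comp (mfderiv (𝓡 d) (𝓡 d) (fun y : N ↦ γ • y) y) :=
    mfderiv_comp y ((hp.contMDiff _).mdifferentiableAt (by simp))
      ((DeckGroup.contMDiff hp γ y).mdifferentiableAt (by simp))
  -- The tangent spaces at `p (γ • y)` and `p y` are distinct types, so `p ∘ γ = p` is used by
  -- substitution.
  have hinner : ∀ g : N → M, g = p →
      inner ℝ (mfderiv (𝓡 d) (𝓡 d) g y v) (mfderiv (𝓡 d) (𝓡 d) g y v) = inner ℝ v v := by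
    rintro g rfl
    exact hp.inner_mfderiv y v v
  have h := hinner (p ∘ fun y : N ↦ γ • y) (funext (DeckGroup.proj_smul γ))
  rw [hchain] at h
  have h' : inner ℝ (mfderiv (𝓡 d) (𝓡 d) (fun y : N ↦ γ • y) y v)
      (mfderiv (𝓡 d) (𝓡 d) (fun y : N ↦ γ • y) y v) = inner ℝ v v :=
    (hp.inner_mfderiv (γ • y) _ _).symm.trans h
  have hnorm : ‖mfderiv (𝓡 d) (𝓡 d) (fun y : N ↦ γ • y) y v‖ = ‖v‖ := by
    rw [norm_eq_sqrt_real_inner, norm_eq_sqrt_real_inner v, h']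
  rw [← ofReal_norm, ← ofReal_norm, hnorm]

end

variable [MetricSpace N] [ChartedSpace (EuclideanSpace ℝ (Fin d)) N]
    [RiemannianBundle (fun y : N => TangentSpace (𝓡 d) y)] [IsManifold (𝓡 d) ∞ N]
    [IsRiemannianManifold (𝓡 d) N] {p : N → M}

theorem DeckGroup.isIsometricSMul (hp : IsUniversalRiemannianCovering d p) :
    IsIsometricSMul (DeckGroup p) N := by
  have hlip : ∀ (γ : DeckGroup p) (y z : N), edist (γ • y) (γ • z) ≤ edist y z := by
    intro γ y z
    have h : LipschitzOnWith 1 (fun y : N ↦ γ • y) (ball y (dist z y + 1)) := by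
      refine lipschitzOnWith_ball_of_enorm_mfderiv_le (I := 𝓡 d) (I' := 𝓡 d) ?_ ?_
      · exact ((DeckGroup.contMDiff hp γ).of_le (by simp)).contMDiffOn
      · intro x _ v
        rw [DeckGroup.enorm_mfderiv hp γ x v]
        simp
    have hy : y ∈ ball y (dist z y + 1) := mem_ball_self (by positivity)
    simpa using h hy (show z ∈ ball y (dist z y + 1) by simp)
  refine ⟨fun γ y z ↦ le_antisymm (hlip γ y z) ?_⟩
  simpa using hlip γ⁻¹ (γ • y) (γ • z)

end Isometry

/-! ### Properness of uniformly locally compact length spaces -/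

section Proper

variable {E : Type*} [NormedAddCommGroup E] [NormedSpace ℝ E]
  {H : Type*} [TopologicalSpace H] (I : ModelWithCorners ℝ E H)
  {N : Type*} [PseudoMetricSpace N] [ChartedSpace H N]
  [RiemannianBundle (fun x : N => TangentSpace I x)] [IsRiemannianManifold I N]

include I in
/-- A Riemannian manifold is a length space. -/
theorem exists_dist_lt_dist_lt_of_dist_lt_add {x y : N} {s t : ℝ} (hs : 0 < s) (ht : 0 < t)
    (hxy : dist x y < s + t) : ∃ z, dist x z < s ∧ dist z y < t := by
  rcases lt_or_ge (dist x y) s with hlt | hge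
  · exact ⟨y, hlt, by simpa using ht⟩
  rw [← edist_lt_ofReal, IsRiemannianManifold.out (I := I) x y] at hxy
  obtain ⟨c, rfl, rfl, hc, hlen⟩ := exists_lt_of_riemannianEDist_lt hxy
  obtain ⟨ℓ, hℓ, hlenℓ, hℓst⟩ : ∃ ℓ : ℝ, 0 ≤ ℓ ∧ pathELength I c 0 1 = ENNReal.ofReal ℓ ∧
      ℓ < s + t := by
    refine ⟨(pathELength I c 0 1).toReal, ENNReal.toReal_nonneg,
      (ENNReal.ofReal_toReal hlen.ne_top).symm, ?_⟩
    exact (ENNReal.lt_ofReal_iff_toReal_lt hlen.ne_top).1 hlen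
  -- The point is chosen on the path at distance `s'` from its origin, for some `s' < s` such that
  -- the rest of the path is shorter than `t`.
  set s' := max 0 ((ℓ - t + s) / 2) with hs'
  have hs'0 : 0 ≤ s' := le_max_left _ _
  have hs's : s' < s := max_lt hs (by linarith)
  have hs't : ℓ - t < s' := lt_of_lt_of_le (by linarith) (le_max_right _ _)
  obtain ⟨u, hu, hus⟩ : s' ∈ (fun u ↦ dist (c 0) (c u)) '' Icc 0 1 :=
    intermediate_value_Icc zero_le_one ((continuous_const.dist continuous_id).comp_continuousOn hc.continuousOn)
      ⟨by simpa using hs'0, hs's.le.trans hge⟩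
  refine ⟨c u, hus.trans_lt hs's, ?_⟩
  have hsum : ENNReal.ofReal (s' + dist (c u) (c 1)) ≤ ENNReal.ofReal ℓ := by
    rw [ENNReal.ofReal_add hs'0 dist_nonneg, ← hlenℓ, ← pathELength_add hu.1 hu.2, ← hus,
      ← edist_dist, ← edist_dist]
    exact add_le_add (edist_le_pathELength hc le_rfl hu.1 hu.2)
      (edist_le_pathELength hc hu.1 hu.2 le_rfl)
  rw [ENNReal.ofReal_le_ofReal_iff hℓ] at hsum
  linarith

include I in
/-- A weak form of the Hopf–Rinow theorem: balls of a fixed radius being compact, one reaches larger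
balls by covering the current ball by finitely many small ones. -/
theorem properSpace_of_isCompact_closedBall {δ : ℝ} (hδ : 0 < δ)
    (hcomp : ∀ q : N, IsCompact (closedBall q δ)) : ProperSpace N := by
  have hsub : ∀ (q : N) (n : ℕ), ∃ K, IsCompact K ∧ ball q ((n + 1) * (δ / 2)) ⊆ K := by
    intro q n
    induction n with
    | zero =>
      exact ⟨_, hcomp q, ball_subset_closedBall.trans (closedBall_subset_closedBall (by simp [hδ.le]))⟩
    | succ n ih =>
      obtain ⟨K, hK, hsub⟩ := ih
      obtain ⟨t, -, ht, hKt⟩ := hK.finite_cover_balls (half_pos hδ)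
      refine ⟨⋃ x ∈ t, closedBall x δ, ht.isCompact_biUnion fun x _ ↦ hcomp x, fun y hy ↦ ?_⟩
      obtain ⟨z, hqz, hzy⟩ := exists_dist_lt_dist_lt_of_dist_lt_add I (x := q) (y := y)
        (s := (n + 1) * (δ / 2)) (t := δ / 2) (by positivity) (by positivity) (by
          rw [mem_ball'] at hy
          push_cast at hy
          linarith)
      obtain ⟨x, hxt, hzx⟩ := mem_iUnion₂.1 (hKt (hsub (mem_ball'.2 hqz)))
      refine mem_iUnion₂.2 ⟨x, hxt, ?_⟩
      rw [mem_ball] at hzx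
      have := dist_triangle_left y x z
      rw [mem_closedBall]
      linarith
  refine ⟨fun q R ↦ ?_⟩
  obtain ⟨n, hn⟩ := exists_nat_gt (R / (δ / 2))
  obtain ⟨K, hK, hqK⟩ := hsub q n
  rw [div_lt_iff₀ (half_pos hδ)] at hn
  refine hK.of_isClosed_subset isClosed_closedBall
    ((closedBall_subset_ball ?_).trans hqK)
  linarith

end Proper

/-! ### The deck group acts cocompactly and properly -/

section Cocompact

variable {M N : Type*} [TopologicalSpace M] [TopologicalSpace N] {p : N → M}

theorem DeckGroup.exists_isCompact_forall_exists_smul_eq [CompactSpace M]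
    [PathConnectedSpace M] [SimplyConnectedSpace N] [LocallyPathConnectedSpace N]
    [WeaklyLocallyCompactSpace N] (hp : IsCoveringMap p) :
    ∃ K : Set N, IsCompact K ∧ ∀ z : N, ∃ γ : DeckGroup p, ∃ y ∈ K, γ • y = z := by
  choose U hUc hU using fun y : N ↦ exists_compact_mem_nhds y
  obtain ⟨t, ht⟩ := isCompact_univ.elim_finite_subcover (fun y ↦ p '' interior (U y))
    (fun y ↦ hp.isLocalHomeomorph.isOpenMap _ isOpen_interior) (fun x _ ↦ by
      obtain ⟨y, rfl⟩ := hp.surjective_of_pathConnectedSpace x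
      exact mem_iUnion.2 ⟨y, mem_image_of_mem p (mem_interior_iff_mem_nhds.2 (hU y))⟩)
  refine ⟨⋃ y ∈ t, U y, t.isCompact_biUnion fun y _ ↦ hUc y, fun z ↦ ?_⟩
  obtain ⟨y, hyt, x, hxy, hxz⟩ := mem_iUnion₂.1 (ht (mem_univ (p z)))
  obtain ⟨γ, hγ⟩ := DeckGroup.exists_smul_eq hp hxz
  exact ⟨γ, x, mem_iUnion₂.2 ⟨y, hyt, interior_subset hxy⟩, hγ⟩

end Cocompact

section ProperAction

variable {M N : Type*} [TopologicalSpace M] [T1Space M] [PseudoMetricSpace N] [ProperSpace N]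
  [PreconnectedSpace N] {p : N → M}

theorem DeckGroup.finite_setOf_smul_mem_closedBall (hp : IsCoveringMap p) (a b : N) (R : ℝ) :
    {γ : DeckGroup p | γ • a ∈ closedBall b R}.Finite := by
  have hclosed : IsClosed (p ⁻¹' {p a}) := isClosed_singleton.preimage hp.continuous
  have hdisc : DiscreteTopology (p ⁻¹' {p a}) := (hp (p a)).discreteTopology_fiber
  have hfin : (closedBall b R ∩ p ⁻¹' {p a}).Finite := by
    refine ((isCompact_closedBall b R).inter_right hclosed).finite ?_
    exact (isDiscrete_iff_discreteTopology.2 hdisc).mono inter_subset_right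
  have hmaps : MapsTo (fun γ : DeckGroup p ↦ γ • a) {γ | γ • a ∈ closedBall b R}
      (closedBall b R ∩ p ⁻¹' {p a}) := fun γ hγ ↦ ⟨hγ, DeckGroup.proj_smul γ a⟩
  refine Set.Finite.of_injOn hmaps ?_ hfin
  intro γ _ γ' _ h
  have : (γ'⁻¹ * γ) • a = a := by
    rw [mul_smul, inv_smul_eq_iff]
    exact h
  exact (inv_mul_eq_one.1 (DeckGroup.isFreeAction hp _ _ this)).symm

theorem DeckGroup.finite_setOf_ball_smul_inter_nonempty (hp : IsCoveringMap p) (a b : N)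
    (r s : ℝ) : {γ : DeckGroup p | (ball (γ • a) r ∩ ball b s).Nonempty}.Finite := by
  refine (DeckGroup.finite_setOf_smul_mem_closedBall hp a b (r + s)).subset ?_
  rintro γ ⟨z, hza, hzb⟩
  rw [mem_ball] at hza hzb
  rw [mem_ofPred_eq, mem_closedBall]
  have := dist_triangle_left (γ • a) b z
  linarith

end ProperAction

/-! ### Cocompact isometric actions -/

section CocompactIsometric

variable {Γ N : Type*} [Group Γ] [MetricSpace N] [MulAction Γ N] [IsIsometricSMul Γ N] {K : Set N}

theorem exists_forall_isCompact_closedBall_of_cocompact [LocallyCompactSpace N]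
    (hK : IsCompact K) (hcov : ∀ z : N, ∃ γ : Γ, ∃ y ∈ K, γ • y = z) :
    ∃ δ > 0, ∀ q : N, IsCompact (closedBall q δ) := by
  obtain ⟨δ, hδ, hcomp⟩ := hK.exists_isCompact_cthickening
  refine ⟨δ, hδ, fun q ↦ ?_⟩
  obtain ⟨γ, y, hy, rfl⟩ := hcov q
  rw [← Metric.smul_closedBall]
  exact (hcomp.of_isClosed_subset isClosed_closedBall
    (closedBall_subset_cthickening hy δ)).smul γ

variable [MeasurableSpace N] [BorelSpace N]

theorem euclideanHausdorffMeasure_ball_smul (d : ℕ) (γ : Γ) (q : N) (r : ℝ) :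
    μHE[d] (ball (γ • q) r) = μHE[d] (ball q r) := by
  rw [← Metric.smul_ball, ← image_smul, (isometry_smul N γ).euclideanHausdorffMeasure_image]

theorem IsGoodBall.smul {d : ℕ} {q : N} {r : ℝ} (h : IsGoodBall d q r) (γ : Γ) :
    IsGoodBall d (γ • q) r where
  radius_pos := h.radius_pos
  reasonable_growth := by
    simpa only [euclideanHausdorffMeasure_ball_smul] using h.reasonable_growth
  volume_bound := by
    simpa only [euclideanHausdorffMeasure_ball_smul] using h.volume_bound
  small_radius := h.small_radius

theorem supVolUnitBall_lt_top_of_cocompact [ProperSpace N] {d : ℕ}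
    [IsLocallyFiniteMeasure (μHE[d] : Measure N)] (hK : IsCompact K)
    (hcov : ∀ z : N, ∃ γ : Γ, ∃ y ∈ K, γ • y = z) : supVolUnitBall d N < ⊤ := by
  have hfin : μHE[d] (cthickening 1 K) < ⊤ :=
    (isCompact_of_isClosed_isBounded isClosed_cthickening hK.isBounded.cthickening).measure_lt_top
  refine (iSup_le fun q ↦ ?_ : supVolUnitBall d N ≤ μHE[d] (cthickening 1 K)).trans_lt hfin
  obtain ⟨γ, y, hy, rfl⟩ := hcov q
  rw [euclideanHausdorffMeasure_ball_smul]
  exact measure_mono (ball_subset_closedBall.trans (closedBall_subset_cthickening hy 1))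

end CocompactIsometric

/-! ### Existence of good balls -/

section GoodBall

variable {d : ℕ} {N : Type*} [MetricSpace N] [MeasurableSpace N] [BorelSpace N]

/-- The radii `10⁻⁴ᵏ / 100` are tried for `k = 0, 1, …`. As long as reasonable growth fails, the
volume of the ball of radius `10⁻⁴ᵏ` shrinks by `10⁻⁴⁽ᵈ⁺³⁾` from one step to the next. This is
faster than the lower bound `c * r ^ d` allows forever, and at the first success it has produced
the bound on the volume. -/
theorem exists_isGoodBall (hV : supVolUnitBall d N < ⊤) {q : N} {c : ℝ≥0∞} (hc : c ≠ 0)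
    {ρ : ℝ} (hρ : 0 < ρ)
    (hlow : ∀ r, 0 < r → r ≤ ρ → c * ENNReal.ofReal r ^ d ≤ μHE[d] (ball q r)) :
    ∃ r, IsGoodBall d q r := by
  set V := supVolUnitBall d N
  let s : ℕ → ℝ := fun k ↦ (1 / 10 ^ 4) ^ k
  have hs0 : ∀ k, 0 < s k := fun k ↦ by positivity
  have hs1 : ∀ k, s k ≤ 1 := fun k ↦ pow_le_one₀ (by norm_num) (by norm_num)
  let T : ℕ → ℝ≥0∞ := fun k ↦ (10 ^ 4) ^ k
  have hsT : ∀ k, ENNReal.ofReal (s k) * T k = 1 := by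
    intro k
    have hT : T k = ENNReal.ofReal ((10 ^ 4) ^ k) := by
      rw [ENNReal.ofReal_pow (by norm_num), ENNReal.ofReal_pow (by norm_num)]
      simp [T]
    rw [hT, ← ENNReal.ofReal_mul (hs0 k).le, ← mul_pow]
    norm_num
  let P : ℕ → Prop := fun k ↦
    μHE[d] (ball q (s k)) ≤ 10 ^ (4 * (d + 3)) * μHE[d] (ball q (s (k + 1)))
  have hdecay : ∀ k, (∀ j < k, ¬ P j) → T k ^ (d + 3) * μHE[d] (ball q (s k)) ≤ V := by
    intro k
    induction k with
    | zero =>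
      intro _
      have : μHE[d] (ball q 1) ≤ V := le_iSup (fun q : N ↦ μHE[d] (ball q 1)) q
      simpa [T, s] using this
    | succ k ih =>
      intro hk
      refine le_trans ?_ (ih fun j hj ↦ hk j (by omega))
      have hT : T (k + 1) ^ (d + 3) = T k ^ (d + 3) * 10 ^ (4 * (d + 3)) := by
        rw [pow_mul, ← mul_pow, ← pow_succ]
      rw [hT, mul_assoc]
      gcongr
      exact (not_le.1 (hk k k.lt_succ_self)).le
  have hex : ∃ k, P k := by
    by_contra! hnot
    obtain ⟨n, hn⟩ := ENNReal.exists_nat_mul_gt hc hV.ne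
    obtain ⟨k₀, hk₀⟩ := exists_pow_lt_of_lt_one hρ (show (1 / 10 ^ 4 : ℝ) < 1 by norm_num)
    set k := max n k₀
    have hsk : s k ≤ ρ :=
      (pow_le_pow_of_le_one (by norm_num) (by norm_num) (le_max_right n k₀)).trans hk₀.le
    have hkT : (n : ℝ≥0∞) ≤ T k ^ 3 := by
      have h1 : n ≤ ((10 ^ 4) ^ k) ^ 3 :=
        calc n ≤ k := le_max_left _ _
          _ ≤ (10 ^ 4) ^ k := (Nat.lt_pow_self (by norm_num)).le
          _ ≤ _ := Nat.le_self_pow (by norm_num) _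
      calc (n : ℝ≥0∞) ≤ ((((10 ^ 4) ^ k) ^ 3 : ℕ) : ℝ≥0∞) := by exact_mod_cast h1
        _ = T k ^ 3 := by norm_num [T]
    have hle : (n : ℝ≥0∞) * c ≤ V :=
      calc (n : ℝ≥0∞) * c ≤ T k ^ 3 * c := by gcongr
        _ = (ENNReal.ofReal (s k) * T k) ^ d * (T k ^ 3 * c) := by rw [hsT, one_pow, one_mul]
        _ = T k ^ (d + 3) * (c * ENNReal.ofReal (s k) ^ d) := by ring
        _ ≤ T k ^ (d + 3) * μHE[d] (ball q (s k)) := by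
          gcongr
          exact hlow _ (hs0 k) hsk
        _ ≤ V := hdecay k fun j _ ↦ hnot j
    exact absurd hle (not_le.2 hn)
  classical
  let k := Nat.find hex
  have hk : P k := Nat.find_spec hex
  refine ⟨s k / 100, by have := hs0 k; positivity, ?_, ?_, by linarith [hs1 k]⟩
  · have h1 : 100 * (s k / 100) = s k := by ring
    have h2 : 1 / 100 * (s k / 100) = s (k + 1) := by
      simp only [s]
      ring
    rw [h1, h2]
    exact hk
  · have hball : ball q (s k / 100) ⊆ ball q (s k) :=
      ball_subset_ball (by linarith [hs0 k])
    have hrad : (10 : ℝ≥0∞) ^ (2 * (d + 3)) * ENNReal.ofReal (s k / 100) ^ (d + 3) =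
        ENNReal.ofReal (s k) ^ (d + 3) := by
      have h100 : ENNReal.ofReal (s k) = 10 ^ 2 * ENNReal.ofReal (s k / 100) := by
        rw [show (10 : ℝ≥0∞) ^ 2 = ENNReal.ofReal 100 by norm_num,
          ← ENNReal.ofReal_mul (by norm_num)]
        congr 1
        ring
      rw [h100, mul_pow, ← pow_mul]
    calc μHE[d] (ball q (s k / 100)) ≤ μHE[d] (ball q (s k)) := measure_mono hball
      _ = (ENNReal.ofReal (s k) * T k) ^ (d + 3) * μHE[d] (ball q (s k)) := by
        rw [hsT, one_pow, one_mul]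
      _ = ENNReal.ofReal (s k) ^ (d + 3) * (T k ^ (d + 3) * μHE[d] (ball q (s k))) := by ring
      _ ≤ ENNReal.ofReal (s k) ^ (d + 3) * V := by
        gcongr
        exact hdecay k fun j hj ↦ Nat.find_min hex hj
      _ = 10 ^ (2 * (d + 3)) * V * ENNReal.ofReal (s k / 100) ^ (d + 3) := by
        rw [← hrad]
        ring

end GoodBall

/-! ### Clopen sets disjoint from their translates -/

section Clopen

variable {Γ X : Type*} [Group Γ] [TopologicalSpace X] [MulAction Γ X] [ContinuousConstSMul Γ X]

theorem IsClopen.smul_set {s : Set X} (hs : IsClopen s) (γ : Γ) : IsClopen (γ • s) :=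
  ⟨hs.1.smul γ, hs.2.smul γ⟩

theorem exists_isClopen_disjoint_smul [CompactSpace X] [T2Space X] [TotallyDisconnectedSpace X]
    (hfree : IsFreeAction Γ X) {S : Set Γ} (hS : S.Finite) (x : X) :
    ∃ P : Set X, IsClopen P ∧ x ∈ P ∧ ∀ γ ∈ S, γ ≠ 1 → Disjoint (γ • P) P := by
  have hsep : ∀ γ : Γ, ∃ P : Set X, IsClopen P ∧ x ∈ P ∧ (γ ≠ 1 → Disjoint (γ • P) P) := by
    intro γ
    rcases eq_or_ne γ 1 with rfl | hγ
    · exact ⟨univ, isClopen_univ, mem_univ x, fun h ↦ (h rfl).elim⟩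
    obtain ⟨u, v, hu, hv, hxu, hxv, huv⟩ := t2_separation fun h ↦ hγ (hfree γ x h)
    obtain ⟨P, hP, hxP, hPsub⟩ := compact_exists_isClopen_in_isOpen
      (hv.inter (hu.preimage (continuous_const_smul γ))) ⟨hxv, hxu⟩
    refine ⟨P, hP, hxP, fun _ ↦ huv.mono ?_ fun z hz ↦ (hPsub hz).1⟩
    rintro _ ⟨z, hz, rfl⟩
    exact (hPsub hz).2
  choose P hP hxP hdisj using hsep
  refine ⟨⋂ γ ∈ S, P γ, hS.isClopen_biInter fun γ _ ↦ hP γ, mem_iInter₂.2 fun γ _ ↦ hxP γ,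
    fun γ hγ hγ1 ↦ (hdisj γ hγ1).mono ?_ ?_⟩
  · exact smul_set_mono (biInter_subset_of_mem hγ)
  · exact biInter_subset_of_mem hγ

theorem exists_finite_isClopen_cover_disjoint_smul [CompactSpace X] [T2Space X]
    [TotallyDisconnectedSpace X] (hfree : IsFreeAction Γ X) {S : Set Γ} (hS : S.Finite) :
    ∃ 𝒬 : Set (Set X), 𝒬.Finite ∧ ⋃₀ 𝒬 = univ ∧
      ∀ P ∈ 𝒬, IsClopen P ∧ ∀ γ ∈ S, γ ≠ 1 → Disjoint (γ • P) P := by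
  choose P hP hxP hdisj using exists_isClopen_disjoint_smul hfree hS
  obtain ⟨t, ht⟩ := isCompact_univ.elim_finite_subcover P (fun x ↦ (hP x).isOpen)
    (fun x _ ↦ mem_iUnion.2 ⟨x, hxP x⟩)
  refine ⟨P '' t, t.finite_toSet.image P, ?_, ?_⟩
  · rw [sUnion_image]
    exact univ_subset_iff.1 ht
  · rintro _ ⟨x, -, rfl⟩
    exact ⟨hP x, hdisj x⟩

end Clopen

/-! ### Greedy selection of clopen sets -/

section Greedy

variable {Γ X : Type*} [Group Γ] [MulAction Γ X] {L : ℕ}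

/-- Greedy selection: given sets `P k` and, for `l < k`, the set `S k l` of those `γ` for which
`(γ, l)` is in conflict with `(1, k)`, keep the points of `P k` that do not lie in `γ • A` for a
set `A` selected at a stage `l < k` and some `γ ∈ S k l`. -/
def greedySelection (P : Fin L → Set X) (S : Fin L → Fin L → Set Γ) (k : Fin L) : Set X :=
  P k \ ⋃ (l : Fin L) (_ : l < k), ⋃ γ ∈ S k l, γ • greedySelection P S l
termination_by k

variable {P : Fin L → Set X} {S : Fin L → Fin L → Set Γ}

theorem greedySelection_subset (k : Fin L) : greedySelection P S k ⊆ P k := by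
  rw [greedySelection]
  exact sdiff_subset

theorem isClopen_greedySelection [TopologicalSpace X] [ContinuousConstSMul Γ X]
    (hP : ∀ k, IsClopen (P k)) (hS : ∀ k l, (S k l).Finite) (k : Fin L) :
    IsClopen (greedySelection P S k) := by
  induction k using WellFoundedLT.induction with
  | ind k ih =>
    rw [greedySelection]
    refine (hP k).diff (isClopen_iUnion_of_finite fun l ↦ isClopen_iUnion_of_finite fun hl ↦ ?_)
    exact (hS k l).isClopen_biUnion fun γ _ ↦ (ih l hl).smul_set γ

theorem notMem_smul_greedySelection {k l : Fin L} (hlk : l < k) {γ : Γ} (hγ : γ ∈ S k l) {x : X}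
    (hx : x ∈ greedySelection P S k) : x ∉ γ • greedySelection P S l := by
  rw [greedySelection] at hx
  exact fun h ↦ hx.2 (mem_iUnion₂.2 ⟨l, hlk, mem_iUnion₂.2 ⟨γ, hγ, h⟩⟩)

theorem mem_greedySelection_or_exists {k : Fin L} {x : X} (hx : x ∈ P k) :
    x ∈ greedySelection P S k ∨ ∃ l < k, ∃ γ ∈ S k l, x ∈ γ • greedySelection P S l := by
  rw [or_iff_not_imp_right]
  intro h
  rw [greedySelection]
  refine ⟨hx, fun h' ↦ h ?_⟩
  obtain ⟨l, hl, h'⟩ := mem_iUnion₂.1 h'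
  obtain ⟨γ, hγ, h'⟩ := mem_iUnion₂.1 h'
  exact ⟨l, hl, γ, hγ, h'⟩

end Greedy

/-! ### Construction of the cover -/

section Construction

variable {Γ X : Type*} {N : Type*} [Group Γ] [TopologicalSpace X] [MulAction Γ X]
  [ContinuousConstSMul Γ X] [MetricSpace N] [MulAction Γ N] [IsIsometricSMul Γ N]

/-- The greedy form of Vitali's covering argument, carried out simultaneously for all points of
`X`. The last two conclusions say that over every `x : X` the halves of the balls cover `N` and the
sixths are pairwise disjoint. -/
theorem exists_cantorCover_of_antitone {L : ℕ} {c : Fin L → N} {r : Fin L → ℝ}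
    {P : Fin L → Set X} (hr : ∀ k, 0 < r k) (hanti : Antitone r) (hP : ∀ k, IsClopen (P k))
    (hself : ∀ (k : Fin L) (γ : Γ), (ball (γ • c k) (r k) ∩ ball (c k) (r k)).Nonempty →
      (γ • P k ∩ P k).Nonempty → γ = 1)
    (hfin : ∀ (a b : N) (s t : ℝ), {γ : Γ | (ball (γ • a) s ∩ ball b t).Nonempty}.Finite)
    (hcov : ∀ (x : X) (y : N), ∃ (k : Fin L) (γ : Γ),
      x ∈ γ • P k ∧ y ∈ ball (γ • c k) (1 / 6 * r k)) :
    ∃ (_ : MulAction Γ (Γ × Fin L)) (U : CantorCover Γ X N (Γ × Fin L)),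
      U.NoSelfIntersections ∧
      (∀ j, U.center j = j.1 • c j.2 ∧ U.radius j = r j.2) ∧
      (∀ x, ⋃ j : {j // x ∈ U.A j}, ball (U.center j) (1 / 2 * U.radius j) = univ) ∧
      ∀ i j, i ≠ j → (U.A i ∩ U.A j).Nonempty →
        Disjoint (ball (U.center i) (1 / 6 * U.radius i))
          (ball (U.center j) (1 / 6 * U.radius j)) := by
  let S : Fin L → Fin L → Set Γ := fun k l ↦
    {γ | (ball (γ • c l) (1 / 6 * r l) ∩ ball (c k) (1 / 6 * r k)).Nonempty}
  set A := greedySelection P S with hA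
  let act : MulAction Γ (Γ × Fin L) :=
    { smul := fun γ j ↦ (γ * j.1, j.2)
      one_smul := fun j ↦ Prod.ext (one_mul _) rfl
      mul_smul := fun γ γ' j ↦ Prod.ext (mul_assoc _ _ _) rfl }
  have hsmul : ∀ (γ : Γ) (j : Γ × Fin L), γ • j = (γ * j.1, j.2) := fun _ _ ↦ rfl
  have hhalf : ∀ (x : X) (y : N), ∃ j : Γ × Fin L, x ∈ j.1 • A j.2 ∧
      y ∈ ball (j.1 • c j.2) (1 / 2 * r j.2) := by
    intro x y
    obtain ⟨k, γ, hx, hy⟩ := hcov x y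
    rw [mem_smul_set_iff_inv_smul_mem] at hx
    rcases mem_greedySelection_or_exists (S := S) hx with h | ⟨l, hlk, γ', hγ', h⟩
    · refine ⟨(γ, k), mem_smul_set_iff_inv_smul_mem.2 h, ball_subset_ball ?_ hy⟩
      have := hr k
      dsimp only
      linarith
    · refine ⟨(γ * γ', l), ?_, ?_⟩
      · rw [mem_smul_set_iff_inv_smul_mem, mul_inv_rev, mul_smul]
        exact mem_smul_set_iff_inv_smul_mem.1 h
      · obtain ⟨z, hzl, hzk⟩ := hγ'
        -- Both sixths contain `γ • z`, and the radius at the earlier stage `l` is the larger one.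
        have h1 : dist (γ • z) ((γ * γ') • c l) < 1 / 6 * r l := by
          rw [mul_smul, dist_smul]
          exact hzl
        have h2 : dist (γ • z) (γ • c k) < 1 / 6 * r k := by
          rw [dist_smul]
          exact hzk
        rw [mem_ball] at hy ⊢
        have := hanti hlk.le
        have := dist_triangle_right y (γ • z) (γ • c k)
        have := dist_triangle y (γ • z) ((γ * γ') • c l)
        dsimp only
        linarith
  have hearlier : ∀ {k l : Fin L} {g g' : Γ} {x : X}, l < k → x ∈ g • A k → x ∈ g' • A l →
      Disjoint (ball (g' • c l) (1 / 6 * r l)) (ball (g • c k) (1 / 6 * r k)) := by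
    intro k l g g' x hlk hx hx'
    rw [mem_smul_set_iff_inv_smul_mem] at hx
    rw [Set.disjoint_iff_inter_eq_empty, ← not_nonempty_iff_eq_empty]
    rintro ⟨z, hzl, hzk⟩
    refine notMem_smul_greedySelection (S := S) (γ := g⁻¹ * g') hlk ⟨g⁻¹ • z, ?_, ?_⟩ hx ?_
    · rw [mul_smul, mem_ball, dist_smul]
      exact hzl
    · rw [mem_ball, ← dist_smul g, smul_inv_smul]
      exact hzk
    · rwa [mul_smul, smul_mem_smul_set_iff]
  have hsame : ∀ {k : Fin L} {g g' : Γ} {x : X}, x ∈ g • A k → x ∈ g' • A k →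
      (ball (g • c k) (r k) ∩ ball (g' • c k) (r k)).Nonempty → g = g' := by
    rintro k g g' x hx hx' ⟨z, hz, hz'⟩
    rw [mem_smul_set_iff_inv_smul_mem] at hx'
    refine (inv_mul_eq_one.1 (hself k (g'⁻¹ * g) ⟨g'⁻¹ • z, ?_, ?_⟩ ⟨g'⁻¹ • x, ?_, ?_⟩)).symm
    · rw [mul_smul, mem_ball, dist_smul]
      exact hz
    · rw [mem_ball, ← dist_smul g', smul_inv_smul]
      exact hz'
    · rw [mul_smul, smul_mem_smul_set_iff]
      exact smul_set_mono (greedySelection_subset k) hx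
    · exact greedySelection_subset k hx'
  let U : CantorCover Γ X N (Γ × Fin L) :=
    { A := fun j ↦ j.1 • A j.2
      center := fun j ↦ j.1 • c j.2
      radius := fun j ↦ r j.2
      free := fun γ j h ↦ mul_eq_right.1 (congrArg Prod.fst h)
      cofinite := by
        refine Finite.of_surjective
          (fun k : Fin L ↦ (Quotient.mk'' (1, k) : MulAction.orbitRel.Quotient Γ (Γ × Fin L))) ?_
        rintro ⟨g, k⟩
        refine ⟨k, Quotient.sound' ?_⟩
        exact ⟨g⁻¹, Prod.ext (inv_mul_cancel g) rfl⟩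
      isClopen := fun j ↦ (isClopen_greedySelection hP (fun _ _ ↦ hfin _ _ _ _) j.2).smul_set j.1
      radius_pos := fun j ↦ hr j.2
      A_smul := fun γ j ↦ by rw [hsmul, mul_smul]
      center_smul := fun γ j ↦ by rw [hsmul, mul_smul]
      radius_smul := fun γ j ↦ rfl
      ball_smul := fun γ j ↦ by rw [hsmul, mul_smul, Metric.smul_ball]
      cover := by
        refine eq_univ_of_forall fun ⟨x, y⟩ ↦ ?_
        obtain ⟨j, hx, hy⟩ := hhalf x y
        exact mem_iUnion.2 ⟨j, hx, ball_subset_ball (by linarith [hr j.2]) hy⟩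
      cover_half := by
        refine eq_univ_of_forall fun ⟨x, y⟩ ↦ ?_
        obtain ⟨j, hx, hy⟩ := hhalf x y
        exact mem_iUnion.2 ⟨j, hx, hy⟩ }
  refine ⟨act, U, ?_, fun j ↦ ⟨rfl, rfl⟩, fun x ↦ eq_univ_of_forall fun y ↦ ?_, ?_⟩
  · rintro γ ⟨g, k⟩ ⟨⟨x, y⟩, ⟨hx, hy⟩, ⟨hx', hy'⟩⟩
    change x ∈ γ • g • A k at hx
    change y ∈ γ • ball (g • c k) (r k) at hy
    rw [← mul_smul] at hx
    rw [Metric.smul_ball, ← mul_smul] at hy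
    exact mul_eq_right.1 (hsame hx hx' ⟨y, hy, hy'⟩)
  · obtain ⟨j, hx, hy⟩ := hhalf x y
    exact mem_iUnion.2 ⟨⟨j, hx⟩, hy⟩
  · rintro ⟨g, k⟩ ⟨g', l⟩ hne ⟨x, hx, hx'⟩
    rcases lt_trichotomy k l with hkl | rfl | hlk
    · exact hearlier hkl hx' hx
    · rw [Set.disjoint_iff_inter_eq_empty, ← not_nonempty_iff_eq_empty]
      rintro ⟨z, hz, hz'⟩
      have hle : 1 / 6 * r k ≤ r k := by linarith [hr k]
      exact hne (Prod.ext (hsame hx hx' ⟨z, ball_subset_ball hle hz, ball_subset_ball hle hz'⟩) rfl)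
    · exact (hearlier hlk hx hx').symm

theorem exists_cantorCover [CompactSpace X] [T2Space X] [TotallyDisconnectedSpace X]
    (hfree : IsFreeAction Γ X) {K : Set N} (hK : IsCompact K)
    (hcocompact : ∀ z : N, ∃ γ : Γ, ∃ y ∈ K, γ • y = z)
    (hfin : ∀ (a b : N) (s t : ℝ), {γ : Γ | (ball (γ • a) s ∩ ball b t).Nonempty}.Finite)
    [MeasurableSpace N] [BorelSpace N] {d : ℕ} (hgood : ∀ q : N, ∃ r, IsGoodBall d q r) :
    ∃ (L : ℕ) (_ : MulAction Γ (Γ × Fin L)) (U : CantorCover Γ X N (Γ × Fin L)),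
      U.IsGood d ∧ U.NoSelfIntersections ∧ ∀ j, IsGoodBall d (U.center j) (U.radius j) := by
  choose R hR using hgood
  have hRpos : ∀ q, 0 < R q := fun q ↦ (hR q).radius_pos
  obtain ⟨t, -, ht⟩ := hK.elim_nhds_subcover (fun q ↦ ball q (1 / 6 * R q))
    fun q _ ↦ ball_mem_nhds q (by have := hRpos q; positivity)
  choose 𝒬 h𝒬fin h𝒬cov h𝒬 using fun q : N ↦
    exists_finite_isClopen_cover_disjoint_smul hfree (hfin q q (R q) (R q))
  -- An index is a ball together with one of the clopen sets chosen for that ball. The indices are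
  -- listed by decreasing radius.
  have : ∀ q, Finite (𝒬 q) := fun q ↦ (h𝒬fin q).to_subtype
  obtain ⟨L, ⟨e⟩⟩ := Finite.exists_equiv_fin (Σ q : t, 𝒬 q)
  let σ := Tuple.sort fun k : Fin L ↦ -R (e.symm k).1
  let f : Fin L ≃ Σ q : t, 𝒬 q := σ.trans e.symm
  have hanti : Antitone fun k ↦ R (f k).1 := by
    intro k l hkl
    exact neg_le_neg_iff.1 (Tuple.monotone_sort (fun k : Fin L ↦ -R (e.symm k).1) hkl)
  have hself : ∀ (k : Fin L) (γ : Γ),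
      (ball (γ • ((f k).1 : N)) (R (f k).1) ∩ ball ((f k).1 : N) (R (f k).1)).Nonempty →
      (γ • ((f k).2 : Set X) ∩ (f k).2).Nonempty → γ = 1 := by
    intro k γ hball hP
    by_contra hγ
    exact hP.ne_empty ((h𝒬 _ _ (f k).2.2).2 γ hball hγ).inter_eq
  have hcov : ∀ (x : X) (z : N), ∃ (k : Fin L) (γ : Γ),
      x ∈ γ • ((f k).2 : Set X) ∧ z ∈ ball (γ • ((f k).1 : N)) (1 / 6 * R (f k).1) := by
    intro x z
    obtain ⟨γ, y, hy, rfl⟩ := hcocompact z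
    obtain ⟨q, hq, hyq⟩ := mem_iUnion₂.1 (ht hy)
    obtain ⟨P, hP, hxP⟩ := mem_sUnion.1 ((h𝒬cov q).symm ▸ mem_univ (γ⁻¹ • x))
    refine ⟨f.symm ⟨⟨q, hq⟩, ⟨P, hP⟩⟩, γ, ?_, ?_⟩
    · rw [f.apply_symm_apply, mem_smul_set_iff_inv_smul_mem]
      exact hxP
    · rw [f.apply_symm_apply, mem_ball, dist_smul]
      exact hyq
  obtain ⟨act, U, hU, hUj, hhalf, hdisj⟩ := exists_cantorCover_of_antitone (Γ := Γ) (X := X)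
    (c := fun k ↦ ((f k).1 : N)) (r := fun k ↦ R (f k).1) (P := fun k ↦ ((f k).2 : Set X))
    (fun k ↦ hRpos _) hanti (fun k ↦ (h𝒬 _ _ (f k).2.2).1) hself hfin hcov
  have hgoodU : ∀ j, IsGoodBall d (U.center j) (U.radius j) := fun j ↦ by
    rw [(hUj j).1, (hUj j).2]
    exact (hR _).smul j.1
  refine ⟨L, act, U, fun x ↦ ⟨fun j ↦ hgoodU j, ?_, hhalf x, fun i j hij ↦ ?_⟩, hU, hgoodU⟩
  · refine univ_subset_iff.1 ((hhalf x).symm.subset.trans (iUnion_mono fun j ↦ ?_))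
    exact ball_subset_ball (by linarith [U.radius_pos j])
  · exact hdisj i j (Subtype.coe_ne_coe.2 hij) ⟨x, i.2, j.2⟩

end Construction

theorem theorem6 (d : ℕ)
    -- a closed connected Riemannian manifold
    (M : Type*) [MetricSpace M] [ChartedSpace (EuclideanSpace ℝ (Fin d)) M]
    [IsManifold (𝓡 d) ∞ M] [RiemannianBundle (fun x : M => TangentSpace (𝓡 d) x)]
    [IsContMDiffRiemannianBundle (𝓡 d) ∞ (EuclideanSpace ℝ (Fin d))
      (fun x : M => TangentSpace (𝓡 d) x)]
    [IsRiemannianManifold (𝓡 d) M] [CompactSpace M] [ConnectedSpace M]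
    -- its universal cover
    (N : Type v) [MetricSpace N] [MeasurableSpace N] [BorelSpace N]
    [ChartedSpace (EuclideanSpace ℝ (Fin d)) N]
    [IsManifold (𝓡 d) ∞ N] [RiemannianBundle (fun y : N => TangentSpace (𝓡 d) y)]
    [IsContMDiffRiemannianBundle (𝓡 d) ∞ (EuclideanSpace ℝ (Fin d))
      (fun y : N => TangentSpace (𝓡 d) y)]
    [IsRiemannianManifold (𝓡 d) N]
    (p : N → M) (hp : IsUniversalRiemannianCovering d p)
    -- the Cantor set with a free continuous action
    (X : Type*) [TopologicalSpace X] (hX : Nonempty (X ≃ₜ (ℕ → Bool)))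
    [MulAction (DeckGroup p) X] [ContinuousConstSMul (DeckGroup p) X]
    (hfree : IsFreeAction (DeckGroup p) X) :
    ∃ (J : Type v) (_ : MulAction (DeckGroup p) J) (U : CantorCover (DeckGroup p) X N J),
      U.IsGood d ∧ U.NoSelfIntersections ∧
        ∀ j, IsGoodBall d (U.center j) (U.radius j) := by
  have := hp.simplyConnected
  have : LocallyPathConnectedSpace N :=
    ChartedSpace.locallyPathConnectedSpace (EuclideanSpace ℝ (Fin d)) N
  have : LocallyPathConnectedSpace M :=
    ChartedSpace.locallyPathConnectedSpace (EuclideanSpace ℝ (Fin d)) M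
  have : PathConnectedSpace M := pathConnectedSpace_iff_connectedSpace.2 inferInstance
  have : LocallyCompactSpace N :=
    ChartedSpace.locallyCompactSpace (EuclideanSpace ℝ (Fin d)) N
  -- Instance search does not find continuity of the metric from its smoothness.
  have : IsContinuousRiemannianBundle (EuclideanSpace ℝ (Fin d))
      (fun y : N => TangentSpace (𝓡 d) y) := by
    obtain ⟨g, hg, hinner⟩ := IsContMDiffRiemannianBundle.exists_contMDiff (IB := 𝓡 d) (n := ∞)
      (F := EuclideanSpace ℝ (Fin d)) (E := fun y : N => TangentSpace (𝓡 d) y)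
    exact ⟨g, hg.continuous, hinner⟩
  have := DeckGroup.isIsometricSMul hp
  have : IsLocallyFiniteMeasure (μHE[d] : Measure N) :=
    isLocallyFiniteMeasure_euclideanHausdorffMeasure
  obtain ⟨K, hK, hcocompact⟩ :=
    DeckGroup.exists_isCompact_forall_exists_smul_eq hp.isCoveringMap
  obtain ⟨δ, hδ, hball⟩ := exists_forall_isCompact_closedBall_of_cocompact hK hcocompact
  have : ProperSpace N := properSpace_of_isCompact_closedBall (𝓡 d) hδ hball
  have hV : supVolUnitBall d N < ⊤ := supVolUnitBall_lt_top_of_cocompact hK hcocompact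
  have hgood : ∀ q : N, ∃ r, IsGoodBall d q r := by
    intro q
    obtain ⟨c, hc, ρ, hρ, hlow⟩ := exists_mul_pow_le_volume_ball (d := d) q
    exact exists_isGoodBall hV hc hρ hlow
  obtain ⟨e⟩ := hX
  have : CompactSpace X := e.symm.compactSpace
  have : T2Space X := e.isEmbedding.t2Space
  have : TotallyDisconnectedSpace X := e.symm.totallyDisconnectedSpace
  obtain ⟨L, act, U, hU⟩ := exists_cantorCover hfree hK hcocompact
    (DeckGroup.finite_setOf_ball_smul_inter_nonempty hp.isCoveringMap) hgood
  exact ⟨DeckGroup p × Fin L, act, U, hU⟩
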